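/- Let $J=\begin{pmatrix}0&0&1\\0&1&0\\1&0&0\end{pmatrix}$, let $\langle z,w\rangle=w^*Jz$ be the associated Hermitian form on $\mathbb C^3$ (of signature $(2,1)$), and let $\mathrm{SU}(J)=\{A\in\mathrm{SL}(3,\mathbb C): A^*JA=J\}$. An element $A$ is loxodromic if its eigenvalues $\lambda_A,\mu_A,\nu_A$ satisfy $|\lambda_A|>|\mu_A|>|\nu_A|$; write $\mathbf a_A,\mathbf r_A$ for (arbitrarily chosen) eigenvectors of $A$ for $\lambda_A$ and $\nu_A$ respectively. For loxodromic $A,B\in \mathrm{SU}(J)$ put $$\mathbb X_1=\frac{\langle\mathbf r_A,\mathbf a_B\rangle\langle\mathbf r_B,\mathbf a_A\rangle}{\langle\mathbf r_B,\mathbf a_B\rangle\langle\mathbf r_A,\mathbf a_A\rangle},\quad \mathbb X_2=\frac{\langle\mathbf a_A,\mathbf a_B\rangle\langle\mathbf r_B,\mathbf r_A\rangle}{\langle\mathbf r_B,\mathbf a_B\rangle\langle\mathbf a_A,\mathbf r_A\rangle},\quad \mathbb X_3=\frac{\langle\mathbf a_B,\mathbf a_A\rangle\langle\mathbf r_B,\mathbf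 r_A\rangle}{\langle\mathbf r_B,\mathbf a_A\rangle\langle\mathbf a_B,\mathbf r_A\rangle},$$ the last one when $\langle\mathbf r_B,\mathbf a_A\rangle\neq0$ and $\langle\mathbf a_B,\mathbf r_A\rangle\ne0$. Put $C=(AB)^{-1}$, $\sigma_+=\mathrm{tr}(A^{-1}B)-\mathrm{tr}(A^{-1})\mathrm{tr}(B)$, $\sigma_-=\mathrm{tr}(B^{-1}A)-\mathrm{tr}(B^{-1})\mathrm{tr}(A)$, $[A,B]=ABA^{-1}B^{-1}$, and let $$y=(y_1,\dots,y_8)=\bigl(\mathrm{tr}A,\mathrm{tr}B,\mathrm{tr}C,\sigma_+,\mathrm{tr}A^{-1},\mathrm{tr}B^{-1},\mathrm{tr}C^{-1},\sigma_-\bigr).$$ The commutator quadratic of $(A,B)$ is $Q(X)=X^2-S(y)X+P(y)$, where $$S=y_1y_5+y_2y_6+y_3y_7+y_4y_8-y_1y_2y_3-y_5y_6y_7-3,$$ $$\begin{aligned}P={}&y_1y_2y_3y_5y_6y_7+y_1^2y_2^2y_7+y_3y_5^2y_6^2+y_1^2y_3^2y_6+y_2y_5^2y_7^2+y_2^2y_3^2y_5+y_1y_6^2y_7^2\\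 &+y_1y_2y_5y_6+y_2y_3y_6y_7+y_1y_3y_5y_7-2y_1y_2y_7^2-2y_3^2y_5y_6-2y_1y_3y_6^2-2y_2^2y_5y_7-2y_2y_3y_5^2-2y_1^2y_6y_7\\ &+y_1^3+y_2^3+y_3^3+y_5^3+y_6^3+y_7^3+3y_1y_2y_3+3y_5y_6y_7-6y_1y_5-6y_2y_6-6y_3y_7\\ &+y_1y_2y_4y_5y_7+y_1y_3y_4y_6y_7+y_2y_3y_4y_5y_6+y_1y_2^2y_4+y_4y_5^2y_6+y_1^2y_3y_4+y_4y_5y_7^2+y_2y_3^2y_4+y_4y_6^2y_7\\ &+y_1y_3y_5y_6y_8+y_2y_3y_5y_7y_8+y_1y_2y_6y_7y_8+y_5y_6^2y_8+y_1^2y_2y_8+y_5^2y_7y_8+y_1y_3^2y_8+y_6y_7^2y_8+y_2^2y_3y_8\\ &+(y_4^2-3y_8)(y_1y_7+y_2y_5+y_3y_6)+(y_8^2-3y_4)(y_1y_6+y_2y_7+y_3y_5)+y_4y_8(y_1y_5+y_2y_6+y_3y_7-6)+y_4^3+y_8^3+9.\end{aligned}$$ Proposition. (1) The denominators of $\mathbb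 X_1,\mathbb X_2$ never vanish. There are a map $\tau$, restricting to a bijection from $\{\lambda\in\mathbb C:|\lambda|>1\}$ onto the set of traces of loxodromic elements of $\mathrm{SU}(J)$, and, for all $\lambda,\lambda'\in\mathbb C$, a real-affine bijection $\varphi_{\lambda,\lambda'}:\mathbb C^2\to\mathbb C^2$ depending only on $\lambda,\lambda'$, such that for all loxodromic $A,B\in\mathrm{SU}(J)$ $$\mathrm{tr}A=\tau(\lambda_A),\qquad \mathrm{tr}B=\tau(\lambda_B),\qquad (\mathrm{tr}\,C,\sigma_+)=\varphi_{\lambda_A,\lambda_B}(\mathbb X_1,\mathbb X_2).$$ The map $(\lambda,\lambda',x_1,x_2)\mapsto(\tau(\lambda),\tau(\lambda'),\varphi_{\lambda,\lambda'}(x_1,x_2))$ is a bijection from the set of values of $(\lambda_A,\lambda_B,\mathbb X_1,\mathbb X_2)$ onto the set of values of $(\mathrm{tr}A,\mathrm{tr}B,\mathrm{tr}\,C,\sigma_+)$, where $(A,B)$ runs over all pairs of loxodromic elements of $\mathrm{SU}(J)$. (2) For all loxodromic $A,B\in\mathrm{SU}(J)$ the roots of $Q$, with multiplicity, are $\mathrm{tr}[A,B]$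 and $\overline{\mathrm{tr}[A,B]}$. If $\mathbb X_3$ is defined, then $\operatorname{sign}(\operatorname{Im}\mathbb X_3)=-\operatorname{sign}(\operatorname{Im}\mathrm{tr}[A,B])$. If $(A,B)$ and $(A',B')$ are two pairs of loxodromic elements with $\mathbb X_3$ defined and with the same $(\lambda_A,\lambda_B,\mathbb X_1,\mathbb X_2)$, then they have the same $Q$, and the signs of the imaginary parts of their $\mathbb X_3$ agree if and only if $\mathrm{tr}[A,B]=\mathrm{tr}[A',B']$, that is, if and only if they pick the same root of $Q$. -/

import Mathlib

open Matrix Polynomial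
open scoped ComplexConjugate commutatorElement

namespace ParkerPlatis

/-- The matrix `J` of the Hermitian form of signature `(2,1)`. -/
def J : Matrix (Fin 3) (Fin 3) ℂ := !![0, 0, 1; 0, 1, 0; 1, 0, 0]

/-- The Hermitian form `⟨z, w⟩ = w^* J z` (linear in `z`, conjugate linear in `w`). -/
noncomputable def form (z w : Fin 3 → ℂ) : ℂ := star w ⬝ᵥ (J *ᵥ z)

/-- `SU(J)`: the matrices of determinant one that preserve the Hermitian form. -/
def SUJ : Subgroup (SpecialLinearGroup (Fin 3) ℂ) where
  carrier := {A | (A : Matrix (Fin 3) (Fin 3) ℂ)ᴴ * J * (A : Matrix (Fin 3) (Fin 3) ℂ) = J}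
  one_mem' := by
    change (1 : Matrix (Fin 3) (Fin 3) ℂ)ᴴ * J * 1 = J
    simp
  mul_mem' := by
    intro A B hA hB
    change A.1ᴴ * J * A.1 = J at hA
    change B.1ᴴ * J * B.1 = J at hB
    change (A.1 * B.1)ᴴ * J * (A.1 * B.1) = J
    calc _ = B.1ᴴ * (A.1ᴴ * J * A.1) * B.1 := by
            simp only [conjTranspose_mul, Matrix.mul_assoc]
      _ = J := by rw [hA, hB]
  inv_mem' := by
    intro A hA
    change A.1ᴴ * J * A.1 = J at hA
    have h : A.1 * A⁻¹.1 = 1 := congrArg Subtype.val (mul_inv_cancel A)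
    have h' : A⁻¹.1ᴴ * A.1ᴴ = 1 := by rw [← conjTranspose_mul, h, conjTranspose_one]
    change A⁻¹.1ᴴ * J * A⁻¹.1 = J
    calc _ = A⁻¹.1ᴴ * (A.1ᴴ * J * A.1) * A⁻¹.1 := by rw [hA]
      _ = (A⁻¹.1ᴴ * A.1ᴴ) * J * (A.1 * A⁻¹.1) := by simp only [Matrix.mul_assoc]
      _ = J := by rw [h, h', Matrix.one_mul, Matrix.mul_one]

/-- The trace of an element of `SL(3, ℂ)`. -/
noncomputable def tr (A : SpecialLinearGroup (Fin 3) ℂ) : ℂ :=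
  (A : Matrix (Fin 3) (Fin 3) ℂ).trace

/-- The eigenvalues of `A`, with algebraic multiplicity, are `l, m, n`, and `|l| > |m| > |n|`. -/
def HasOrderedEigenvalues (A : SpecialLinearGroup (Fin 3) ℂ) (l m n : ℂ) : Prop :=
  (A : Matrix (Fin 3) (Fin 3) ℂ).charpoly.roots = {l, m, n} ∧ ‖m‖ < ‖l‖ ∧ ‖n‖ < ‖m‖

/-- `A` is loxodromic: its eigenvalues have pairwise different absolute values. -/
def IsLoxodromic (A : SpecialLinearGroup (Fin 3) ℂ) : Prop :=
  ∃ l m n : ℂ, HasOrderedEigenvalues A l m n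

/-- A loxodromic element `A` of `SU(J)` with its eigenvalues `|l| > |m| > |n|`, a chosen attracting
eigenvector `a` (for the eigenvalue `l`) and a chosen repelling eigenvector `r` (for `n`). -/
structure Loxodromic where
  A : SpecialLinearGroup (Fin 3) ℂ
  l : ℂ
  m : ℂ
  n : ℂ
  a : Fin 3 → ℂ
  r : Fin 3 → ℂ
  mem : A ∈ SUJ
  eigenvalues : HasOrderedEigenvalues A l m n
  a_ne : a ≠ 0
  r_ne : r ≠ 0
  a_eigen : (A : Matrix (Fin 3) (Fin 3) ℂ) *ᵥ a = l • a
  r_eigen : (A : Matrix (Fin 3) (Fin 3) ℂ) *ᵥ r = n • r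

/-- Every loxodromic element of `SU(J)` occurs in the preceding structure. -/
theorem exists_loxodromic {A : SpecialLinearGroup (Fin 3) ℂ} (hA : A ∈ SUJ)
    (h : IsLoxodromic A) : ∃ E : Loxodromic, E.A = A := by
  obtain ⟨l, m, n, h⟩ := h
  have key : ∀ k ∈ (A : Matrix (Fin 3) (Fin 3) ℂ).charpoly.roots,
      ∃ v : Fin 3 → ℂ, v ≠ 0 ∧ (A : Matrix (Fin 3) (Fin 3) ℂ) *ᵥ v = k • v := by
    intro k hk
    have hroot := (mem_roots'.1 hk).2
    have hev : Module.End.HasEigenvalue (Matrix.toLin' (A : Matrix (Fin 3) (Fin 3) ℂ)) k := by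
      rw [Module.End.hasEigenvalue_iff_isRoot_charpoly, Matrix.charpoly_toLin']
      exact hroot
    obtain ⟨v, hv⟩ := hev.exists_hasEigenvector
    exact ⟨v, hv.2, by simpa using hv.apply_eq_smul⟩
  obtain ⟨a, ha, ha'⟩ := key l (by rw [h.1]; simp)
  obtain ⟨r, hr, hr'⟩ := key n (by rw [h.1]; simp)
  exact ⟨⟨A, l, m, n, a, r, hA, h, ha, hr, ha', hr'⟩, rfl⟩

/-- The cross-ratio `X₁` of the eigenvectors of `A` and `B`. -/
noncomputable def X1 (E F : Loxodromic) : ℂ :=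
  (form E.r F.a * form F.r E.a) / (form F.r F.a * form E.r E.a)

/-- The cross-ratio `X₂` of the eigenvectors of `A` and `B`. -/
noncomputable def X2 (E F : Loxodromic) : ℂ :=
  (form E.a F.a * form F.r E.r) / (form F.r F.a * form E.a E.r)

/-- The cross-ratio `X₃` of the eigenvectors of `A` and `B`; it is defined when
`⟨r_B, a_A⟩` and `⟨a_B, r_A⟩` are nonzero. -/
noncomputable def X3 (E F : Loxodromic) : ℂ :=
  (form F.a E.a * form F.r E.r) / (form F.r E.a * form F.a E.r)

/-- `σ₊ = tr(A⁻¹B) - tr(A⁻¹) tr(B)`. -/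
noncomputable def sigmaPlus (A B : SpecialLinearGroup (Fin 3) ℂ) : ℂ :=
  tr (A⁻¹ * B) - tr A⁻¹ * tr B

/-- `σ₋ = tr(B⁻¹A) - tr(B⁻¹) tr(A)`. -/
noncomputable def sigmaMinus (A B : SpecialLinearGroup (Fin 3) ℂ) : ℂ :=
  tr (B⁻¹ * A) - tr B⁻¹ * tr A

/-- `(λ_A, λ_B, X₁, X₂)`. -/
noncomputable def eigenCoords (E F : Loxodromic) : ℂ × ℂ × ℂ × ℂ :=
  (E.l, F.l, X1 E F, X2 E F)

/-- `(tr A, tr B, tr C, σ₊)` where `C = (AB)⁻¹`. -/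
noncomputable def traceCoords (A B : SpecialLinearGroup (Fin 3) ℂ) : ℂ × ℂ × ℂ × ℂ :=
  (tr A, tr B, tr (A * B)⁻¹, sigmaPlus A B)

/-- The polynomial giving the sum of the roots of the commutator quadratic. -/
def S (y₁ y₂ y₃ y₄ y₅ y₆ y₇ y₈ : ℂ) : ℂ :=
  y₁ * y₅ + y₂ * y₆ + y₃ * y₇ + y₄ * y₈ - y₁ * y₂ * y₃ - y₅ * y₆ * y₇ - 3

/-- The polynomial giving the product of the roots of the commutator quadratic. -/
def P (y₁ y₂ y₃ y₄ y₅ y₆ y₇ y₈ : ℂ) : ℂ :=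
  y₁ * y₂ * y₃ * y₅ * y₆ * y₇
  + y₁ ^ 2 * y₂ ^ 2 * y₇ + y₃ * y₅ ^ 2 * y₆ ^ 2
  + y₁ ^ 2 * y₃ ^ 2 * y₆ + y₂ * y₅ ^ 2 * y₇ ^ 2
  + y₂ ^ 2 * y₃ ^ 2 * y₅ + y₁ * y₆ ^ 2 * y₇ ^ 2
  + y₁ * y₂ * y₅ * y₆ + y₂ * y₃ * y₆ * y₇ + y₁ * y₃ * y₅ * y₇
  - 2 * y₁ * y₂ * y₇ ^ 2 - 2 * y₃ ^ 2 * y₅ * y₆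
  - 2 * y₁ * y₃ * y₆ ^ 2 - 2 * y₂ ^ 2 * y₅ * y₇
  - 2 * y₂ * y₃ * y₅ ^ 2 - 2 * y₁ ^ 2 * y₆ * y₇
  + y₁ ^ 3 + y₂ ^ 3 + y₃ ^ 3 + y₅ ^ 3 + y₆ ^ 3 + y₇ ^ 3
  + 3 * y₁ * y₂ * y₃ + 3 * y₅ * y₆ * y₇ - 6 * y₁ * y₅ - 6 * y₂ * y₆ - 6 * y₃ * y₇
  + y₁ * y₂ * y₄ * y₅ * y₇ + y₁ * y₃ * y₄ * y₆ * y₇ + y₂ * y₃ * y₄ * y₅ * y₆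
  + y₁ * y₂ ^ 2 * y₄ + y₄ * y₅ ^ 2 * y₆ + y₁ ^ 2 * y₃ * y₄
  + y₄ * y₅ * y₇ ^ 2 + y₂ * y₃ ^ 2 * y₄ + y₄ * y₆ ^ 2 * y₇
  + y₁ * y₃ * y₅ * y₆ * y₈ + y₂ * y₃ * y₅ * y₇ * y₈ + y₁ * y₂ * y₆ * y₇ * y₈
  + y₅ * y₆ ^ 2 * y₈ + y₁ ^ 2 * y₂ * y₈ + y₅ ^ 2 * y₇ * y₈
  + y₁ * y₃ ^ 2 * y₈ + y₆ * y₇ ^ 2 * y₈ + y₂ ^ 2 * y₃ * y₈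
  + (y₄ ^ 2 - 3 * y₈) * (y₁ * y₇ + y₂ * y₅ + y₃ * y₆)
  + (y₈ ^ 2 - 3 * y₄) * (y₁ * y₆ + y₂ * y₇ + y₃ * y₅)
  + y₄ * y₈ * (y₁ * y₅ + y₂ * y₆ + y₃ * y₇ - 6) + y₄ ^ 3 + y₈ ^ 3 + 9

/-- The commutator quadratic `Q = X² - S(y) X + P(y)`, where `y` consists of the traces of `A`, `B`,
`C = (AB)⁻¹` and of their inverses and of the shape invariants `σ₊`, `σ₋`. -/
noncomputable def Q (A B : SpecialLinearGroup (Fin 3) ℂ) : ℂ[X] :=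
  X ^ 2
  - C (S (tr A) (tr B) (tr (A * B)⁻¹) (sigmaPlus A B)
        (tr A⁻¹) (tr B⁻¹) (tr (A * B)) (sigmaMinus A B)) * X
  + C (P (tr A) (tr B) (tr (A * B)⁻¹) (sigmaPlus A B)
        (tr A⁻¹) (tr B⁻¹) (tr (A * B)) (sigmaMinus A B))

/-- The cross-ratio `X₃` is defined: its denominator does not vanish. -/
def X3Defined (E F : Loxodromic) : Prop :=
  form F.r E.a ≠ 0 ∧ form F.a E.r ≠ 0

end ParkerPlatis

/-! In an eigenbasis of `A`, write `B` and `D = B⁻¹` in coordinates. Both `tr [A,B]` and `tr [B,A]`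
are weighted sums of the numbers `B i j * D j i`, with transposed weights. These numbers have row
and column sums one, which fixes their symmetric part by the diagonal and leaves a single
antisymmetric parameter. Its square is polynomial in the diagonal entries because a principal 2×2
minor of `B` or `D` is an entry of the other. This yields the sum, product and difference of the two
traces (`trace_commutator`). In `SU(J)` inversion conjugates traces, so the two traces are conjugate
and are the roots of `Q`.

A loxodromic element is a scalar plus two rank-one maps built from its null eigenvectors
(`matrix_eq`). Hence `tr (AB)` and `tr (A⁻¹B)` are real-affine in `X1`, `X2`, with coefficients
given by the eigenvalues. The strict inequality `norm_n_sub_m_lt` makes this affine map invertible.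
It also makes the eigenvalue discriminants positive, so that `tr [A,B] - conj (tr [A,B])` is a
positive multiple of `conj X3 - X3` (`exists_im_tr_commutator_eq`). The leading eigenvalue is
recovered from the trace as the only root of the characteristic polynomial outside the unit circle.
-/

namespace ParkerPlatis

/-! ### Commutator traces in `SL(3, ℂ)` with one factor diagonalizable. -/

/-- The value of `S` for the traces belonging to a diagonal matrix with entries `lᵢ` and a matrix
with diagonal entries `bᵢ` whose inverse has diagonal entries `dᵢ`. -/
theorem S_diagonal {l₁ l₂ l₃ b₁ b₂ b₃ d₁ d₂ d₃ : ℂ} (h : l₁ * l₂ * l₃ = 1) :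
    S (l₁ + l₂ + l₃) (b₁ + b₂ + b₃) (l₂ * l₃ * d₁ + l₁ * l₃ * d₂ + l₁ * l₂ * d₃)
      ((l₂ * l₃ * b₁ + l₁ * l₃ * b₂ + l₁ * l₂ * b₃)
        - (l₂ * l₃ + l₁ * l₃ + l₁ * l₂) * (b₁ + b₂ + b₃))
      (l₂ * l₃ + l₁ * l₃ + l₁ * l₂) (d₁ + d₂ + d₃) (l₁ * b₁ + l₂ * b₂ + l₃ * b₃)
      ((l₁ * d₁ + l₂ * d₂ + l₃ * d₃) - (d₁ + d₂ + d₃) * (l₁ + l₂ + l₃)) =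
    2 * (b₁ * d₁ + b₂ * d₂ + b₃ * d₃)
      + (l₁ * (l₁ * l₃) + l₂ * (l₂ * l₃)) * (1 - b₁ * d₁ - b₂ * d₂ + b₃ * d₃)
      + (l₂ * (l₁ * l₂) + l₃ * (l₁ * l₃)) * (1 - b₂ * d₂ - b₃ * d₃ + b₁ * d₁)
      + (l₃ * (l₂ * l₃) + l₁ * (l₁ * l₂)) * (1 - b₁ * d₁ - b₃ * d₃ + b₂ * d₂) := by
  simp only [S]
  linear_combination (2 * (b₁ * d₁ + b₂ * d₂ + b₃ * d₃) + 3
    - (b₁ + b₂ + b₃) * (d₁ + d₂ + d₃)) * h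

/-- The discriminant of the commutator quadratic for the same traces, made homogeneous of degree
six in the `lᵢ` by powers of their product `L`. -/
theorem P_diagonal_homogeneous (l₁ l₂ l₃ b₁ b₂ b₃ d₁ d₂ d₃ L y₁ y₂ y₃ y₄ y₅ y₆ y₇ y₈ : ℂ)
    (hL : L = l₁ * l₂ * l₃) (h₁ : y₁ = l₁ + l₂ + l₃) (h₂ : y₂ = b₁ + b₂ + b₃)
    (h₃ : y₃ = l₂ * l₃ * d₁ + l₁ * l₃ * d₂ + l₁ * l₂ * d₃)
    (h₅ : y₅ = l₂ * l₃ + l₁ * l₃ + l₁ * l₂)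
    (h₄ : y₄ = (l₂ * l₃ * b₁ + l₁ * l₃ * b₂ + l₁ * l₂ * b₃)
        - (l₂ * l₃ + l₁ * l₃ + l₁ * l₂) * (b₁ + b₂ + b₃))
    (h₆ : y₆ = d₁ + d₂ + d₃) (h₇ : y₇ = l₁ * b₁ + l₂ * b₂ + l₃ * b₃)
    (h₈ : y₈ = (l₁ * d₁ + l₂ * d₂ + l₃ * d₃) - (d₁ + d₂ + d₃) * (l₁ + l₂ + l₃)) :
  4 * (y₁ * y₂ * y₃ * y₅ * y₆ * y₇
  + L * y₁ ^ 2 * y₂ ^ 2 * y₇ + y₃ * y₅ ^ 2 * y₆ ^ 2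
  + y₁ ^ 2 * y₃ ^ 2 * y₆ + y₂ * y₅ ^ 2 * y₇ ^ 2
  + y₂ ^ 2 * y₃ ^ 2 * y₅ + L * y₁ * y₆ ^ 2 * y₇ ^ 2
  + L * y₁ * y₂ * y₅ * y₆ + L * y₂ * y₃ * y₆ * y₇ + y₁ * y₃ * y₅ * y₇
  - 2 * L * y₁ * y₂ * y₇ ^ 2 - 2 * y₃ ^ 2 * y₅ * y₆
  - 2 * L * y₁ * y₃ * y₆ ^ 2 - 2 * L * y₂ ^ 2 * y₅ * y₇
  - 2 * y₂ * y₃ * y₅ ^ 2 - 2 * L * y₁ ^ 2 * y₆ * y₇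
  + L * y₁ ^ 3 + L ^ 2 * y₂ ^ 3 + y₃ ^ 3 + y₅ ^ 3 + L ^ 2 * y₆ ^ 3 + L * y₇ ^ 3
  + 3 * L * y₁ * y₂ * y₃ + 3 * L * y₅ * y₆ * y₇ - 6 * L * y₁ * y₅ - 6 * L ^ 2 * y₂ * y₆
  - 6 * L * y₃ * y₇
  + y₁ * y₂ * y₄ * y₅ * y₇ + y₁ * y₃ * y₄ * y₆ * y₇ + y₂ * y₃ * y₄ * y₅ * y₆
  + L * y₁ * y₂ ^ 2 * y₄ + y₄ * y₅ ^ 2 * y₆ + y₁ ^ 2 * y₃ * y₄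
  + y₄ * y₅ * y₇ ^ 2 + y₂ * y₃ ^ 2 * y₄ + L * y₄ * y₆ ^ 2 * y₇
  + y₁ * y₃ * y₅ * y₆ * y₈ + y₂ * y₃ * y₅ * y₇ * y₈ + L * y₁ * y₂ * y₆ * y₇ * y₈
  + L * y₅ * y₆ ^ 2 * y₈ + L * y₁ ^ 2 * y₂ * y₈ + y₅ ^ 2 * y₇ * y₈
  + y₁ * y₃ ^ 2 * y₈ + L * y₆ * y₇ ^ 2 * y₈ + L * y₂ ^ 2 * y₃ * y₈
  + (y₄ ^ 2 - 3 * L * y₈) * (y₁ * y₇ + y₂ * y₅ + y₃ * y₆)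
  + (y₈ ^ 2 * L - 3 * L * y₄) * (y₁ * y₆ + y₂ * y₇)
  + (y₈ ^ 2 - 3 * y₄) * (y₃ * y₅)
  + y₄ * y₈ * (y₁ * y₅ + L * y₂ * y₆ + y₃ * y₇ - 6 * L) + y₄ ^ 3 + L * y₈ ^ 3 + 9 * L ^ 2) =
    (y₁ * y₅ + L * y₂ * y₆ + y₃ * y₇ + y₄ * y₈ - y₁ * y₂ * y₃ - y₅ * y₆ * y₇ - 3 * L) ^ 2
      - ((l₁ - l₂) * (l₂ - l₃) * (l₁ - l₃)) ^ 2
        * ((1 - b₁ * d₁ - b₂ * d₂ + b₃ * d₃) ^ 2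
          - 4 * (b₁ * b₂ - d₃) * (d₁ * d₂ - b₃)) := by
  subst_vars
  ring

/-- The case `L = 1` of the homogeneous identity. Homogenizing makes that identity hold for all
`lᵢ`, so `ring` proves it without reducing modulo `l₁ * l₂ * l₃ = 1`. -/
theorem four_mul_P_diagonal {l₁ l₂ l₃ b₁ b₂ b₃ d₁ d₂ d₃ : ℂ} (h : l₁ * l₂ * l₃ = 1)
    {y₁ y₂ y₃ y₄ y₅ y₆ y₇ y₈ : ℂ} (h₁ : y₁ = l₁ + l₂ + l₃) (h₂ : y₂ = b₁ + b₂ + b₃)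
    (h₃ : y₃ = l₂ * l₃ * d₁ + l₁ * l₃ * d₂ + l₁ * l₂ * d₃)
    (h₅ : y₅ = l₂ * l₃ + l₁ * l₃ + l₁ * l₂)
    (h₄ : y₄ = (l₂ * l₃ * b₁ + l₁ * l₃ * b₂ + l₁ * l₂ * b₃)
        - (l₂ * l₃ + l₁ * l₃ + l₁ * l₂) * (b₁ + b₂ + b₃))
    (h₆ : y₆ = d₁ + d₂ + d₃) (h₇ : y₇ = l₁ * b₁ + l₂ * b₂ + l₃ * b₃)
    (h₈ : y₈ = (l₁ * d₁ + l₂ * d₂ + l₃ * d₃) - (d₁ + d₂ + d₃) * (l₁ + l₂ + l₃)) :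
    4 * P y₁ y₂ y₃ y₄ y₅ y₆ y₇ y₈ = S y₁ y₂ y₃ y₄ y₅ y₆ y₇ y₈ ^ 2
      - ((l₁ - l₂) * (l₂ - l₃) * (l₁ - l₃)) ^ 2
        * ((1 - b₁ * d₁ - b₂ * d₂ + b₃ * d₃) ^ 2
          - 4 * (b₁ * b₂ - d₃) * (d₁ * d₂ - b₃)) := by
  have key := P_diagonal_homogeneous l₁ l₂ l₃ b₁ b₂ b₃ d₁ d₂ d₃ 1 y₁ y₂ y₃ y₄ y₅ y₆ y₇ y₈
    h.symm h₁ h₂ h₃ h₅ h₄ h₆ h₇ h₈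
  simp only [P, S]
  linear_combination key

/-- The traces of the commutators of a diagonal matrix and an arbitrary matrix of determinant
one. -/
theorem trace_commutator_diagonal {l₁ l₂ l₃ : ℂ} (h : l₁ * l₂ * l₃ = 1)
    {A A' B D : Matrix (Fin 3) (Fin 3) ℂ} (hA : A = diagonal ![l₁, l₂, l₃])
    (hA' : A' = diagonal ![l₂ * l₃, l₁ * l₃, l₁ * l₂]) (hB : B.det = 1) (hD : D = B.adjugate) :
    (A * B * A' * D).trace + (B * A * D * A').trace =
      S A.trace B.trace (D * A').trace ((A' * B).trace - A'.trace * B.trace)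
        A'.trace D.trace (A * B).trace ((D * A).trace - D.trace * A.trace) ∧
    (A * B * A' * D).trace * (B * A * D * A').trace =
      P A.trace B.trace (D * A').trace ((A' * B).trace - A'.trace * B.trace)
        A'.trace D.trace (A * B).trace ((D * A).trace - D.trace * A.trace) ∧
    (A * B * A' * D).trace - (B * A * D * A').trace =
      (l₁ - l₂) * (l₂ - l₃) * (l₁ - l₃) * (B 0 2 * D 2 0 - B 2 0 * D 0 2) := by
  have hBD : B * D = 1 := by rw [hD, mul_adjugate, hB, one_smul]
  have hDB : D * B = 1 := by rw [hD, adjugate_mul, hB, one_smul]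
  have r : ∀ i, B i 0 * D 0 i + B i 1 * D 1 i + B i 2 * D 2 i = 1 := by
    intro i
    have := congrFun (congrFun hBD i) i
    simpa [mul_apply, Fin.sum_univ_three] using this
  have c : ∀ i, D i 0 * B 0 i + D i 1 * B 1 i + D i 2 * B 2 i = 1 := by
    intro i
    have := congrFun (congrFun hDB i) i
    simpa [mul_apply, Fin.sum_univ_three] using this
  -- Jacobi's relation between complementary minors: since the determinant is one, a 2×2 minor of
  -- `B` is an entry of `D`, and conversely.
  have hd : B 0 1 * B 1 0 = B 0 0 * B 1 1 - D 2 2 := by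
    simp [hD, adjugate_fin_three]
  have hb : D 0 1 * D 1 0 = D 0 0 * D 1 1 - B 2 2 := by
    rw [det_fin_three] at hB
    simp [hD, adjugate_fin_three]
    linear_combination (-B 2 2) * hB
  have r0 := r 0
  have r1 := r 1
  have r2 := r 2
  have c0 := c 0
  have c1 := c 1
  have c2 := c 2
  clear r c
  have e₁ : A.trace = l₁ + l₂ + l₃ := by simp [hA, Fin.sum_univ_three]
  have e₂ : B.trace = B 0 0 + B 1 1 + B 2 2 := trace_fin_three B
  have e₃ : (D * A').trace = l₂ * l₃ * D 0 0 + l₁ * l₃ * D 1 1 + l₁ * l₂ * D 2 2 := by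
    simp [hA', trace_fin_three]; ring
  have e₅ : A'.trace = l₂ * l₃ + l₁ * l₃ + l₁ * l₂ := by
    simp [hA', Fin.sum_univ_three]
  have e₄ : (A' * B).trace - A'.trace * B.trace =
      (l₂ * l₃ * B 0 0 + l₁ * l₃ * B 1 1 + l₁ * l₂ * B 2 2)
        - (l₂ * l₃ + l₁ * l₃ + l₁ * l₂) * (B 0 0 + B 1 1 + B 2 2) := by
    rw [e₅, e₂]; simp [hA', trace_fin_three]
  have e₆ : D.trace = D 0 0 + D 1 1 + D 2 2 := trace_fin_three D
  have e₇ : (A * B).trace = l₁ * B 0 0 + l₂ * B 1 1 + l₃ * B 2 2 := by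
    simp [hA, trace_fin_three]
  have e₈ : (D * A).trace - D.trace * A.trace = (l₁ * D 0 0 + l₂ * D 1 1 + l₃ * D 2 2)
      - (D 0 0 + D 1 1 + D 2 2) * (l₁ + l₂ + l₃) := by
    rw [e₆, e₁]; simp [hA, trace_fin_three]; ring
  have t₁ : (A * B * A' * D).trace =
      l₁ * (l₂ * l₃) * (B 0 0 * D 0 0) + l₁ * (l₁ * l₃) * (B 0 1 * D 1 0)
      + l₁ * (l₁ * l₂) * (B 0 2 * D 2 0) + l₂ * (l₂ * l₃) * (B 1 0 * D 0 1)
      + l₂ * (l₁ * l₃) * (B 1 1 * D 1 1) + l₂ * (l₁ * l₂) * (B 1 2 * D 2 1)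
      + l₃ * (l₂ * l₃) * (B 2 0 * D 0 2) + l₃ * (l₁ * l₃) * (B 2 1 * D 1 2)
      + l₃ * (l₁ * l₂) * (B 2 2 * D 2 2) := by
    simp [hA, hA', trace_fin_three, mul_apply, Fin.sum_univ_three, diagonal_apply]; ring
  have t₂ : (B * A * D * A').trace =
      l₁ * (l₂ * l₃) * (B 0 0 * D 0 0) + l₁ * (l₁ * l₃) * (B 1 0 * D 0 1)
      + l₁ * (l₁ * l₂) * (B 2 0 * D 0 2) + l₂ * (l₂ * l₃) * (B 0 1 * D 1 0)
      + l₂ * (l₁ * l₃) * (B 1 1 * D 1 1) + l₂ * (l₁ * l₂) * (B 2 1 * D 1 2)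
      + l₃ * (l₂ * l₃) * (B 0 2 * D 2 0) + l₃ * (l₁ * l₃) * (B 1 2 * D 2 1)
      + l₃ * (l₁ * l₂) * (B 2 2 * D 2 2) := by
    simp [hA, hA', trace_fin_three, mul_apply, Fin.sum_univ_three, diagonal_apply]; ring
  have hP := four_mul_P_diagonal h e₁ e₂ e₃ e₅ e₄ e₆ e₇ e₈
  -- The row and column sums of the matrix `B i j * D j i` are one. This determines its symmetric
  -- part off the diagonal, and makes its antisymmetric part a multiple of one cyclic pattern.
  have s₀₁ : B 0 1 * D 1 0 + B 1 0 * D 0 1 =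
      1 - B 0 0 * D 0 0 - B 1 1 * D 1 1 + B 2 2 * D 2 2 := by
    linear_combination (r0 + c0 + r1 + c1 - r2 - c2) / 2
  have s₁₂ : B 1 2 * D 2 1 + B 2 1 * D 1 2 =
      1 - B 1 1 * D 1 1 - B 2 2 * D 2 2 + B 0 0 * D 0 0 := by
    linear_combination (r2 + c2 + r1 + c1 - r0 - c0) / 2
  have s₀₂ : B 0 2 * D 2 0 + B 2 0 * D 0 2 =
      1 - B 0 0 * D 0 0 - B 2 2 * D 2 2 + B 1 1 * D 1 1 := by
    linear_combination (r2 + c2 + r0 + c0 - r1 - c1) / 2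
  have a₀₁ : B 0 1 * D 1 0 - B 1 0 * D 0 1 = -(B 0 2 * D 2 0 - B 2 0 * D 0 2) := by
    linear_combination r0 - c0
  have a₁₂ : B 1 2 * D 2 1 - B 2 1 * D 1 2 = -(B 0 2 * D 2 0 - B 2 0 * D 0 2) := by
    linear_combination c2 - r2
  have hsum : (A * B * A' * D).trace + (B * A * D * A').trace =
      S A.trace B.trace (D * A').trace ((A' * B).trace - A'.trace * B.trace)
        A'.trace D.trace (A * B).trace ((D * A).trace - D.trace * A.trace) := by
    rw [t₁, t₂, e₄, e₈, e₁, e₂, e₃, e₅, e₆, e₇, S_diagonal h]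
    linear_combination (2 * (B 0 0 * D 0 0 + B 1 1 * D 1 1 + B 2 2 * D 2 2)) * h
      + (l₁ * (l₁ * l₃) + l₂ * (l₂ * l₃)) * s₀₁ + (l₂ * (l₁ * l₂) + l₃ * (l₁ * l₃)) * s₁₂
      + (l₃ * (l₂ * l₃) + l₁ * (l₁ * l₂)) * s₀₂
  have hdiff : (A * B * A' * D).trace - (B * A * D * A').trace =
      (l₁ - l₂) * (l₂ - l₃) * (l₁ - l₃) * (B 0 2 * D 2 0 - B 2 0 * D 0 2) := by
    rw [t₁, t₂]
    linear_combination (l₁ * (l₁ * l₃) - l₂ * (l₂ * l₃)) * a₀₁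
      + (l₂ * (l₁ * l₂) - l₃ * (l₁ * l₃)) * a₁₂
  -- This is `(x - y)² = (x + y)² - 4xy` with `x = B 0 1 * D 1 0` and `y = B 1 0 * D 0 1`; by `a₀₁`,
  -- `x - y` is the parameter up to sign.
  have hsq : (B 0 2 * D 2 0 - B 2 0 * D 0 2) ^ 2 =
      (1 - B 0 0 * D 0 0 - B 1 1 * D 1 1 + B 2 2 * D 2 2) ^ 2
        - 4 * (B 0 0 * B 1 1 - D 2 2) * (D 0 0 * D 1 1 - B 2 2) := by
    rw [← s₀₁, ← hd, ← hb, ← neg_sq, ← a₀₁]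
    ring
  refine ⟨hsum, ?_, hdiff⟩
  rw [← hsq, ← hsum, ← mul_pow, ← hdiff] at hP
  linear_combination (-1 / 4) * hP

/-- Lawton's formulas for the traces of the commutators of two matrices in `SL(3, ℂ)`, the first of
which is diagonalizable. -/
theorem trace_commutator {A B : SpecialLinearGroup (Fin 3) ℂ} {l₁ l₂ l₃ : ℂ}
    (h : l₁ * l₂ * l₃ = 1) {G H : Matrix (Fin 3) (Fin 3) ℂ} (hHG : H * G = 1)
    (hA : A.1 * G = G * diagonal ![l₁, l₂, l₃]) :
    tr ⁅A, B⁆ + tr ⁅B, A⁆ = S (tr A) (tr B) (tr (A * B)⁻¹) (sigmaPlus A B)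
        (tr A⁻¹) (tr B⁻¹) (tr (A * B)) (sigmaMinus A B) ∧
    tr ⁅A, B⁆ * tr ⁅B, A⁆ = P (tr A) (tr B) (tr (A * B)⁻¹) (sigmaPlus A B)
        (tr A⁻¹) (tr B⁻¹) (tr (A * B)) (sigmaMinus A B) ∧
    tr ⁅A, B⁆ - tr ⁅B, A⁆ = (l₁ - l₂) * (l₂ - l₃) * (l₁ - l₃) *
      ((H * B.1 * G) 0 2 * (H * B⁻¹.1 * G) 2 0 - (H * B.1 * G) 2 0 * (H * B⁻¹.1 * G) 0 2) := by
  have hGH : G * H = 1 := mul_eq_one_comm.1 hHG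
  have hmul : ∀ M N : Matrix (Fin 3) (Fin 3) ℂ, H * (M * N) * G = (H * M * G) * (H * N * G) := by
    intro M N
    calc H * (M * N) * G = H * M * 1 * N * G := by simp only [Matrix.mul_assoc, Matrix.one_mul]
      _ = _ := by rw [← hGH]; simp only [Matrix.mul_assoc]
  have htr : ∀ M : Matrix (Fin 3) (Fin 3) ℂ, M.trace = (H * M * G).trace := by
    intro M
    rw [Matrix.trace_mul_comm, ← Matrix.mul_assoc, hGH, Matrix.one_mul]
  have hA₁ : H * A.1 * G = diagonal ![l₁, l₂, l₃] := by
    rw [Matrix.mul_assoc, hA, ← Matrix.mul_assoc, hHG, Matrix.one_mul]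
  have inv_unique : ∀ M N N' : Matrix (Fin 3) (Fin 3) ℂ, M * N = 1 → M * N' = 1 → N' = N := by
    intro M N N' h₁ h₂
    calc N' = (N * M) * N' := by rw [mul_eq_one_comm.1 h₁, Matrix.one_mul]
      _ = N := by rw [Matrix.mul_assoc, h₂, Matrix.mul_one]
  have hone : ∀ M N : Matrix (Fin 3) (Fin 3) ℂ, M * N = 1 → (H * M * G) * (H * N * G) = 1 := by
    intro M N hMN
    rw [← hmul, hMN, Matrix.mul_one, hHG]
  have hA₂ : H * A⁻¹.1 * G = diagonal ![l₂ * l₃, l₁ * l₃, l₁ * l₂] := by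
    refine inv_unique (H * A.1 * G) _ _ ?_
      (hone _ _ (congrArg Subtype.val (mul_inv_cancel A)))
    rw [hA₁, diagonal_mul_diagonal, ← diagonal_one]
    congr 1
    funext i
    fin_cases i <;> simp <;> linear_combination h
  have hB₁ : (H * B.1 * G).det = 1 := by
    have := congrArg det hHG
    rw [det_mul, det_one] at this
    rw [det_mul, det_mul, B.2]
    linear_combination this
  have hB₂ : H * B⁻¹.1 * G = (H * B.1 * G).adjugate := by
    refine inv_unique (H * B.1 * G) _ _ ?_
      (hone _ _ (congrArg Subtype.val (mul_inv_cancel B)))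
    rw [mul_adjugate, hB₁, one_smul]
  have key := trace_commutator_diagonal h hA₁ hA₂ hB₁ hB₂
  simp only [← hmul, ← htr] at key
  simp only [tr, sigmaPlus, sigmaMinus, commutatorElement_def, _root_.mul_inv_rev]
  exact key

/-! ### The Hermitian form and its isometries. -/

theorem form_apply (z w : Fin 3 → ℂ) :
    form z w = conj (w 0) * z 2 + conj (w 1) * z 1 + conj (w 2) * z 0 := by
  simp [form, J, dotProduct, mulVec, Fin.sum_univ_three]

theorem conj_form (z w : Fin 3 → ℂ) : conj (form z w) = form w z := by
  simp [form_apply]; ring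

theorem form_ne_zero_comm {z w : Fin 3 → ℂ} (h : form z w ≠ 0) : form w z ≠ 0 := by
  rw [← conj_form]
  exact (_root_.map_ne_zero _).2 h

theorem form_add_left (x y z : Fin 3 → ℂ) : form (x + y) z = form x z + form y z := by
  simp [form_apply]; ring

theorem form_smul_left (c : ℂ) (x z : Fin 3 → ℂ) : form (c • x) z = c * form x z := by
  simp [form_apply]; ring

theorem form_smul_right (c : ℂ) (x z : Fin 3 → ℂ) : form x (c • z) = conj c * form x z := by
  simp [form_apply]; ring

theorem eq_zero_of_form_right {z : Fin 3 → ℂ} (h : ∀ w, form w z = 0) : z = 0 := by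
  have h0 := h ![0, 0, 1]
  have h1 := h ![0, 1, 0]
  have h2 := h ![1, 0, 0]
  simp [form_apply] at h0 h1 h2
  ext i
  fin_cases i <;> simp [h0, h1, h2]

theorem form_mulVec {A : SpecialLinearGroup (Fin 3) ℂ} (hA : A ∈ SUJ) (z w : Fin 3 → ℂ) :
    form (A.1 *ᵥ z) (A.1 *ᵥ w) = form z w := by
  have h : A.1ᴴ * J * A.1 = J := hA
  unfold form
  rw [star_mulVec, ← dotProduct_mulVec, mulVec_mulVec, mulVec_mulVec, h]

/-- The trace of the inverse of an element of `SU(J)`. -/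
theorem tr_inv {A : SpecialLinearGroup (Fin 3) ℂ} (hA : A ∈ SUJ) : tr A⁻¹ = conj (tr A) := by
  have h : A.1ᴴ * J * A.1 = J := hA
  have hJ : J * J = 1 := by
    ext i j
    fin_cases i <;> fin_cases j <;> simp [J, Matrix.mul_apply, Fin.sum_univ_three]
  have h₁ : A.1 * A⁻¹.1 = 1 := congrArg Subtype.val (mul_inv_cancel A)
  have h₂ : A⁻¹.1 = J * A.1ᴴ * J := by
    calc A⁻¹.1 = J * (A.1ᴴ * J * A.1) * A⁻¹.1 := by rw [h, hJ, Matrix.one_mul]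
      _ = J * A.1ᴴ * J * (A.1 * A⁻¹.1) := by simp only [Matrix.mul_assoc]
      _ = _ := by rw [h₁, Matrix.mul_one]
  change A⁻¹.1.trace = _
  rw [h₂, Matrix.trace_mul_comm, ← Matrix.mul_assoc, hJ, Matrix.one_mul, trace_conjTranspose]
  rfl

/-! ### Eigenvalues and eigenvectors of a loxodromic isometry. -/

namespace Loxodromic

variable (E : Loxodromic)

theorem l_mul_m_mul_n : E.l * E.m * E.n = 1 := by
  have h := Matrix.det_eq_prod_roots_charpoly E.A.1
  rw [E.A.2, E.eigenvalues.1] at h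
  simp only [Multiset.insert_eq_cons, Multiset.prod_cons, Multiset.prod_singleton] at h
  linear_combination -h

theorem norm_l_mul : ‖E.l‖ * ‖E.m‖ * ‖E.n‖ = 1 := by
  rw [← norm_mul, ← norm_mul, E.l_mul_m_mul_n, norm_one]

theorem one_lt_norm_l : 1 < ‖E.l‖ := by
  by_contra! h
  have h₁ := E.eigenvalues.2.1
  have h₂ := E.eigenvalues.2.2
  have h₃ := E.norm_l_mul
  have : ‖E.l‖ * ‖E.m‖ ≤ 1 := mul_le_one₀ h (norm_nonneg _) (h₁.le.trans h)
  have : ‖E.l‖ * ‖E.m‖ * ‖E.n‖ < 1 := by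
    nlinarith [norm_nonneg E.n]
  linarith

theorem norm_n_lt_one : ‖E.n‖ < 1 := by
  by_contra! h
  have h₁ := E.one_lt_norm_l
  have h₂ := E.eigenvalues.2.2
  have h₃ := E.norm_l_mul
  have : 1 < ‖E.l‖ * ‖E.m‖ := one_lt_mul_of_lt_of_le h₁ (h.trans h₂.le)
  nlinarith

theorem tr_eq : tr E.A = E.l + E.m + E.n := by
  have h := Matrix.trace_eq_sum_roots_charpoly E.A.1
  rw [E.eigenvalues.1] at h
  simp only [Multiset.insert_eq_cons, Multiset.sum_cons, Multiset.sum_singleton] at h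
  simp only [tr]
  linear_combination h

-- Invariance of the form gives `x * conj y = 1` whenever the two eigenvectors are not orthogonal.
variable {E} in
theorem form_eq_zero {u v : Fin 3 → ℂ} {x y : ℂ} (hu : E.A.1 *ᵥ u = x • u)
    (hv : E.A.1 *ᵥ v = y • v) (hxy : ‖x‖ * ‖y‖ ≠ 1) : form u v = 0 := by
  have h := form_mulVec E.mem u v
  rw [hu, hv, form_smul_left, form_smul_right] at h
  by_contra h0
  have : x * conj y = 1 := by
    apply mul_right_cancel₀ h0
    linear_combination h
  apply hxy
  rw [← RCLike.norm_conj y, ← norm_mul, this, norm_one]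

/-- Eigenvectors for distinct eigenvalues are independent, so they are the columns of an invertible
`G`. The middle vector `e` is auxiliary: it never enters the cross-ratios. -/
theorem exists_eigenbasis : ∃ (e : Fin 3 → ℂ) (G H : Matrix (Fin 3) (Fin 3) ℂ),
    H * G = 1 ∧ (∀ x, G *ᵥ x = x 0 • E.a + x 1 • e + x 2 • E.r) ∧
    E.A.1 *ᵥ e = E.m • e := by
  obtain ⟨e, he, he'⟩ : ∃ e : Fin 3 → ℂ, e ≠ 0 ∧ E.A.1 *ᵥ e = E.m • e := by
    have hroot : E.A.1.charpoly.IsRoot E.m := by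
      apply (mem_roots'.1 _).2
      rw [E.eigenvalues.1]; simp
    have hev : Module.End.HasEigenvalue (Matrix.toLin' E.A.1) E.m := by
      rwa [Module.End.hasEigenvalue_iff_isRoot_charpoly, Matrix.charpoly_toLin']
    obtain ⟨v, hv⟩ := hev.exists_hasEigenvector
    exact ⟨v, hv.2, by simpa using hv.apply_eq_smul⟩
  have hinj : Function.Injective ![E.l, E.m, E.n] := by
    have h₁ := E.eigenvalues.2.1
    have h₂ := E.eigenvalues.2.2
    have h₃ : E.l ≠ E.m := fun h => by rw [h] at h₁; exact lt_irrefl _ h₁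
    have h₄ : E.m ≠ E.n := fun h => by rw [h] at h₂; exact lt_irrefl _ h₂
    have h₅ : E.l ≠ E.n := fun h => by rw [h] at h₁; exact lt_asymm h₁ h₂
    intro i j hij
    fin_cases i <;> fin_cases j <;> simp_all [eq_comm]
  have hli := Module.End.eigenvectors_linearIndependent' (Matrix.toLin' E.A.1) ![E.l, E.m, E.n]
    hinj ![E.a, e, E.r] (by
      intro i
      fin_cases i
      · exact ⟨Module.End.mem_eigenspace_iff.2 (by simpa using E.a_eigen), E.a_ne⟩
      · exact ⟨Module.End.mem_eigenspace_iff.2 (by simpa using he'), he⟩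
      · exact ⟨Module.End.mem_eigenspace_iff.2 (by simpa using E.r_eigen), E.r_ne⟩)
  have hu : IsUnit (Matrix.of ![E.a, e, E.r]) :=
    Matrix.linearIndependent_rows_iff_isUnit.1 hli
  have hdet := (Matrix.isUnit_iff_isUnit_det _).1 ((Matrix.isUnit_transpose _).2 hu)
  refine ⟨e, (Matrix.of ![E.a, e, E.r])ᵀ, _, Matrix.nonsing_inv_mul _ hdet, ?_, he'⟩
  intro x
  ext i
  simp [mulVec, dotProduct, Fin.sum_univ_three]
  ring

theorem form_a_a : form E.a E.a = 0 := by
  refine form_eq_zero E.a_eigen E.a_eigen (ne_of_gt ?_)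
  nlinarith [E.one_lt_norm_l]

theorem form_r_r : form E.r E.r = 0 := by
  refine form_eq_zero E.r_eigen E.r_eigen (ne_of_lt ?_)
  nlinarith [E.norm_n_lt_one, norm_nonneg E.n]

variable {E} in
theorem form_m_a {e : Fin 3 → ℂ} (he : E.A.1 *ᵥ e = E.m • e) : form e E.a = 0 := by
  refine form_eq_zero he E.a_eigen fun h => ?_
  have h₁ := E.norm_l_mul
  have h₂ := E.norm_n_lt_one
  rw [mul_comm ‖E.l‖, h] at h₁
  linarith

variable {E} in
theorem form_m_r {e : Fin 3 → ℂ} (he : E.A.1 *ᵥ e = E.m • e) : form e E.r = 0 := by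
  refine form_eq_zero he E.r_eigen fun h => ?_
  have h₁ := E.norm_l_mul
  have h₂ := E.one_lt_norm_l
  rw [mul_assoc, h] at h₁
  linarith

/-- Nondegeneracy: `E.a` is already orthogonal to itself and to the middle eigenvector, so it cannot
also be orthogonal to `E.r`. -/
theorem form_r_a : form E.r E.a ≠ 0 := by
  obtain ⟨e, G, H, hHG, hG, he⟩ := E.exists_eigenbasis
  intro h
  refine E.a_ne (eq_zero_of_form_right fun w => ?_)
  have hw : w = G *ᵥ (H *ᵥ w) := by
    rw [mulVec_mulVec, mul_eq_one_comm.1 hHG, one_mulVec]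
  rw [hw, hG]
  simp [form_add_left, form_smul_left, E.form_a_a, form_m_a he, h]

theorem form_a_r : form E.a E.r ≠ 0 := form_ne_zero_comm E.form_r_a

theorem n_mul_conj_l : E.n * conj E.l = 1 := by
  have h := form_mulVec E.mem E.r E.a
  rw [E.a_eigen, E.r_eigen, form_smul_left, form_smul_right] at h
  apply mul_right_cancel₀ E.form_r_a
  linear_combination h

theorem n_ne_zero : E.n ≠ 0 := left_ne_zero_of_mul_eq_one E.n_mul_conj_l

/-- With `conj_m` and `conj_n`, this makes conjugation polynomial on the eigenvalues, so that later
identities are algebraic in `l`, `m`, `n`. -/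
theorem conj_l : conj E.l = E.l * E.m := by
  apply mul_left_cancel₀ E.n_ne_zero
  linear_combination E.n_mul_conj_l - E.l_mul_m_mul_n

theorem l_ne_zero : E.l ≠ 0 := fun h => by simpa [h] using E.l_mul_m_mul_n

theorem m_ne_zero : E.m ≠ 0 := fun h => by simpa [h] using E.l_mul_m_mul_n

theorem n_eq : E.n = (conj E.l)⁻¹ := eq_inv_of_mul_eq_one_left E.n_mul_conj_l

theorem m_eq : E.m = conj E.l / E.l := by
  rw [E.conj_l, mul_div_cancel_left₀ _ E.l_ne_zero]

theorem conj_n : conj E.n = E.m * E.n := by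
  have h := congrArg conj E.n_mul_conj_l
  simp only [map_mul, Complex.conj_conj, map_one] at h
  apply mul_right_cancel₀ E.l_ne_zero
  linear_combination h - E.l_mul_m_mul_n

theorem conj_m : conj E.m = E.l * E.n := by
  have h := congrArg conj E.l_mul_m_mul_n
  simp only [map_mul, map_one, E.conj_l, E.conj_n] at h
  apply mul_right_cancel₀ E.m_ne_zero
  linear_combination h - conj E.m * E.m * E.l_mul_m_mul_n - E.l_mul_m_mul_n

/-- Conjugating, `conj (l - m) = l * (m - n)`, and `|l| > 1`. -/
theorem norm_n_sub_m_lt : ‖E.n - E.m‖ < ‖E.l - E.m‖ := by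
  have h : ‖E.l - E.m‖ = ‖E.l‖ * ‖E.n - E.m‖ := by
    rw [← RCLike.norm_conj (E.l - E.m), map_sub, E.conj_l, E.conj_m, ← mul_sub, norm_mul,
      norm_sub_rev]
  have h₀ : 0 < ‖E.n - E.m‖ := by
    rw [norm_pos_iff, sub_ne_zero]
    intro h
    have := E.eigenvalues.2.2
    rw [h] at this
    exact lt_irrefl _ this
  rw [h]
  nlinarith [E.one_lt_norm_l]

end Loxodromic

/-! ### Spectral decomposition, and traces of products through cross-ratios. -/

/-- The matrix of the linear map `x ↦ ⟨x, v⟩ u`. -/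
noncomputable def rankOne (u v : Fin 3 → ℂ) : Matrix (Fin 3) (Fin 3) ℂ :=
  vecMulVec u (star v ᵥ* J)

theorem rankOne_mulVec (u v x : Fin 3 → ℂ) : rankOne u v *ᵥ x = form x v • u := by
  rw [rankOne, vecMulVec_mulVec, ← dotProduct_mulVec]
  ext i
  simp [form, mul_comm]

theorem trace_rankOne (u v : Fin 3 → ℂ) : (rankOne u v).trace = form u v := by
  rw [rankOne, trace_vecMulVec, form, dotProduct_mulVec, dotProduct_comm]

theorem rankOne_mul_rankOne (u v u' v' : Fin 3 → ℂ) :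
    rankOne u v * rankOne u' v' = form u' v • rankOne u v' := by
  rw [rankOne, rankOne, rankOne, vecMulVec_mul_vecMulVec, form, dotProduct_mulVec]
  ext i j
  simp [vecMulVec_apply]
  ring

/-- The matrix with eigenvectors `a` and `r`, for the eigenvalues `y + p` and `y + q`, that is `y`
times the identity on their orthogonal complement. -/
noncomputable def spectral (a r : Fin 3 → ℂ) (y p q : ℂ) : Matrix (Fin 3) (Fin 3) ℂ :=
  y • 1 + (p / form a r) • rankOne a r + (q / form r a) • rankOne r a

/-- A product of two rank-one maps has as trace a product of two form values, so the bilinear part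
consists of four cross-ratios: `X1`, `X2` and their conjugates, once the eigenvectors are inserted.
-/
theorem trace_spectral_mul_spectral {a r a' r' : Fin 3 → ℂ} (h : form a r ≠ 0)
    (h' : form a' r' ≠ 0) (y p q y' p' q' : ℂ) :
    (spectral a r y p q * spectral a' r' y' p' q').trace =
      3 * y * y' + y * (p' + q') + y' * (p + q)
      + p * p' * ((form a' r * form a r') / (form a r * form a' r'))
      + p * q' * ((form r' r * form a a') / (form a r * form r' a'))
      + q * p' * ((form a' a * form r r') / (form r a * form a' r'))
      + q * q' * ((form r' a * form r a') / (form r a * form r' a')) := by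
  have h₂ := form_ne_zero_comm h
  have h₂' := form_ne_zero_comm h'
  simp only [spectral, add_mul, mul_add, smul_mul_assoc, mul_smul_comm, Matrix.one_mul,
    Matrix.mul_one, rankOne_mul_rankOne, trace_add, trace_smul, trace_rankOne, smul_eq_mul,
    trace_one, Fintype.card_fin]
  field_simp
  push_cast
  ring

theorem spectral_mulVec (a r : Fin 3 → ℂ) (y p q : ℂ) (x : Fin 3 → ℂ) :
    spectral a r y p q *ᵥ x =
      y • x + (p / form a r * form x r) • a + (q / form r a * form x a) • r := by
  simp [spectral, add_mulVec, smul_mulVec, rankOne_mulVec, smul_smul]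

namespace Loxodromic

variable (E : Loxodromic)

variable {E} in
theorem eq_spectral {T : Matrix (Fin 3) (Fin 3) ℂ} {x y z : ℂ} (ha : T *ᵥ E.a = x • E.a)
    (hr : T *ᵥ E.r = z • E.r)
    (he : ∀ e, E.A.1 *ᵥ e = E.m • e → T *ᵥ e = y • e) :
    T = spectral E.a E.r y (x - y) (z - y) := by
  obtain ⟨e, G, H, hHG, hG, he'⟩ := E.exists_eigenbasis
  have hGH := mul_eq_one_comm.1 hHG
  have key : T * G = spectral E.a E.r y (x - y) (z - y) * G := by
    apply Matrix.ext_of_mulVec_single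
    intro i
    have h₁ := E.form_a_r
    have h₂ := E.form_r_a
    rw [← mulVec_mulVec, ← mulVec_mulVec, hG, mulVec_add, mulVec_add, mulVec_add, mulVec_add]
    simp only [mulVec_smul, ha, hr, he e he', spectral_mulVec, E.form_a_a, E.form_r_r,
      form_m_a he', form_m_r he', div_mul_cancel₀ _ h₁, div_mul_cancel₀ _ h₂]
    module
  calc T = T * G * H := by rw [Matrix.mul_assoc, hGH, Matrix.mul_one]
    _ = _ := by rw [key, Matrix.mul_assoc, hGH, Matrix.mul_one]

theorem matrix_eq : E.A.1 = spectral E.a E.r E.m (E.l - E.m) (E.n - E.m) :=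
  eq_spectral E.a_eigen E.r_eigen fun _ h => h

variable {E} in
theorem inv_mulVec {v : Fin 3 → ℂ} {x y : ℂ} (hv : E.A.1 *ᵥ v = x • v) (h : y * x = 1) :
    E.A⁻¹.1 *ᵥ v = y • v := by
  have h₁ : E.A⁻¹.1 * E.A.1 = 1 := congrArg Subtype.val (inv_mul_cancel E.A)
  calc E.A⁻¹.1 *ᵥ v = y • (E.A⁻¹.1 *ᵥ (x • v)) := by
        rw [mulVec_smul, smul_smul, h, one_smul]
    _ = _ := by rw [← hv, mulVec_mulVec, h₁, one_mulVec]

/-- The inverses of `l`, `m`, `n` are `conj n`, `conj m`, `conj l`. Inversion therefore keeps the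
rank-one parts and swaps and conjugates their coefficients. -/
theorem inv_matrix_eq : E.A⁻¹.1 =
    spectral E.a E.r (conj E.m) (conj (E.n - E.m)) (conj (E.l - E.m)) := by
  have h := E.l_mul_m_mul_n
  rw [map_sub, map_sub]
  refine eq_spectral (inv_mulVec E.a_eigen ?_) (inv_mulVec E.r_eigen ?_)
    fun e he => inv_mulVec he ?_
  · rw [E.conj_n]; linear_combination h
  · rw [E.conj_l]; linear_combination h
  · rw [E.conj_m]; linear_combination h

variable (F : Loxodromic)

theorem conj_X1 : conj (X1 E F) =
    (form F.a E.r * form E.a F.r) / (form E.a E.r * form F.a F.r) := by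
  simp only [X1, map_div₀, map_mul, conj_form]
  ring

theorem conj_X2 : conj (X2 E F) =
    (form F.a E.a * form E.r F.r) / (form E.r E.a * form F.a F.r) := by
  simp only [X2, map_div₀, map_mul, conj_form]
  ring

theorem tr_mul : tr (E.A * F.A) =
    3 * E.m * F.m + E.m * ((F.l - F.m) + (F.n - F.m)) + F.m * ((E.l - E.m) + (E.n - E.m))
      + (E.l - E.m) * (F.l - F.m) * conj (X1 E F) + (E.l - E.m) * (F.n - F.m) * X2 E F
      + (E.n - E.m) * (F.l - F.m) * conj (X2 E F) + (E.n - E.m) * (F.n - F.m) * X1 E F := by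
  change (E.A.1 * F.A.1).trace = _
  rw [E.matrix_eq, F.matrix_eq, trace_spectral_mul_spectral E.form_a_r F.form_a_r, conj_X1,
    conj_X2, X1, X2]
  ring

theorem tr_inv_mul : tr (E.A⁻¹ * F.A) =
    3 * conj E.m * F.m + conj E.m * ((F.l - F.m) + (F.n - F.m))
      + F.m * (conj (E.l - E.m) + conj (E.n - E.m))
      + conj (E.n - E.m) * (F.l - F.m) * conj (X1 E F) + conj (E.n - E.m) * (F.n - F.m) * X2 E F
      + conj (E.l - E.m) * (F.l - F.m) * conj (X2 E F)
      + conj (E.l - E.m) * (F.n - F.m) * X1 E F := by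
  change (E.A⁻¹.1 * F.A.1).trace = _
  rw [E.inv_matrix_eq, F.matrix_eq, trace_spectral_mul_spectral E.form_a_r F.form_a_r, conj_X1,
    conj_X2, X1, X2]
  ring

end Loxodromic

/-! ### The commutator of two loxodromic isometries and the sign of `Im X3`. -/

namespace Loxodromic

variable (E F : Loxodromic)

theorem tr_commutator (B : SpecialLinearGroup (Fin 3) ℂ) :
    tr ⁅E.A, B⁆ + tr ⁅B, E.A⁆ = S (tr E.A) (tr B) (tr (E.A * B)⁻¹) (sigmaPlus E.A B)
        (tr E.A⁻¹) (tr B⁻¹) (tr (E.A * B)) (sigmaMinus E.A B) ∧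
    tr ⁅E.A, B⁆ * tr ⁅B, E.A⁆ = P (tr E.A) (tr B) (tr (E.A * B)⁻¹) (sigmaPlus E.A B)
        (tr E.A⁻¹) (tr B⁻¹) (tr (E.A * B)) (sigmaMinus E.A B) ∧
    tr ⁅E.A, B⁆ - tr ⁅B, E.A⁆ = (E.l - E.m) * (E.m - E.n) * (E.l - E.n) *
      ((form (B.1 *ᵥ E.r) E.r * form (B⁻¹.1 *ᵥ E.a) E.a
        - form (B.1 *ᵥ E.a) E.a * form (B⁻¹.1 *ᵥ E.r) E.r) / (form E.a E.r * form E.r E.a)) := by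
  obtain ⟨e, G, H, hHG, hG, he⟩ := E.exists_eigenbasis
  have hGH := mul_eq_one_comm.1 hHG
  have hd : E.A.1 * G = G * diagonal ![E.l, E.m, E.n] := by
    apply Matrix.ext_of_mulVec_single
    intro i
    rw [← mulVec_mulVec, ← mulVec_mulVec, hG, hG, mulVec_add, mulVec_add, mulVec_smul,
      mulVec_smul, mulVec_smul, E.a_eigen, he, E.r_eigen]
    simp only [mulVec_diagonal]
    simp [smul_smul, mul_comm]
  have hH : ∀ x, x = (H *ᵥ x) 0 • E.a + (H *ᵥ x) 1 • e + (H *ᵥ x) 2 • E.r := by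
    intro x
    rw [← hG, mulVec_mulVec, hGH, one_mulVec]
  have h₁ := E.form_a_r
  have h₂ := E.form_r_a
  -- `E.r` is orthogonal to itself and to `e`, so pairing with it extracts the coefficient of `E.a`;
  -- `hH₂` is symmetric. Entries with indices 0 and 2 thus involve only `E.a` and `E.r`.
  have hH₀ : ∀ x, (H *ᵥ x) 0 = form x E.r / form E.a E.r := by
    intro x
    rw [eq_div_iff h₁]
    conv_rhs => rw [hH x]
    simp [form_add_left, form_smul_left, E.form_r_r, form_m_r he]
  have hH₂ : ∀ x, (H *ᵥ x) 2 = form x E.a / form E.r E.a := by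
    intro x
    rw [eq_div_iff h₂]
    conv_rhs => rw [hH x]
    simp [form_add_left, form_smul_left, E.form_a_a, form_m_a he]
  have hcol : ∀ (M : Matrix (Fin 3) (Fin 3) ℂ) (i j : Fin 3),
      (H * M * G) i j = (H *ᵥ (M *ᵥ (G *ᵥ Pi.single j 1))) i := by
    intro M i j
    rw [mulVec_mulVec, mulVec_mulVec, mulVec_single_one]
    rfl
  have hG₀ : G *ᵥ Pi.single 0 1 = E.a := by rw [hG]; simp
  have hG₂ : G *ᵥ Pi.single 2 1 = E.r := by rw [hG]; simp
  obtain ⟨k₁, k₂, k₃⟩ := trace_commutator (B := B) E.l_mul_m_mul_n hHG hd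
  refine ⟨k₁, k₂, k₃.trans ?_⟩
  rw [hcol, hcol, hcol, hcol, hG₀, hG₂, hH₀, hH₀, hH₂, hH₂]
  field_simp

/-- The product of the eigenvalue differences of a loxodromic element of `SU(J)` is a
difference of two squares of real numbers. -/
theorem discr_eq : (E.l - E.m) * (E.m - E.n) * (E.l - E.n) =
    ((‖E.l - E.m‖ ^ 2 - ‖E.n - E.m‖ ^ 2 : ℝ) : ℂ) := by
  push_cast
  rw [← Complex.mul_conj', ← Complex.mul_conj', map_sub, map_sub, E.conj_l, E.conj_m, E.conj_n]
  ring

/-- `[B,A]` is the inverse of `[A,B]`, and inversion in `SU(J)` conjugates the trace. -/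
theorem tr_commutator_comm : tr ⁅F.A, E.A⁆ = conj (tr ⁅E.A, F.A⁆) := by
  rw [← commutatorElement_inv, tr_inv]
  rw [commutatorElement_def]
  exact SUJ.mul_mem (SUJ.mul_mem (SUJ.mul_mem E.mem F.mem) (SUJ.inv_mem E.mem))
    (SUJ.inv_mem F.mem)

theorem roots_Q : (Q E.A F.A).roots = {tr ⁅E.A, F.A⁆, conj (tr ⁅E.A, F.A⁆)} := by
  obtain ⟨h₁, h₂, -⟩ := E.tr_commutator F.A
  rw [tr_commutator_comm E F] at h₁ h₂
  have : Q E.A F.A = (X - C (tr ⁅E.A, F.A⁆)) * (X - C (conj (tr ⁅E.A, F.A⁆))) := by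
    rw [Q, ← h₁, ← h₂, C_add, C_mul]
    ring
  rw [this, roots_mul (mul_ne_zero (X_sub_C_ne_zero _) (X_sub_C_ne_zero _)), roots_X_sub_C,
    roots_X_sub_C]
  rfl

theorem form_mulVec_left (x y : Fin 3 → ℂ) : form (F.A.1 *ᵥ x) y =
    F.m * form x y + (F.l - F.m) / form F.a F.r * form x F.r * form F.a y
      + (F.n - F.m) / form F.r F.a * form x F.a * form F.r y := by
  rw [F.matrix_eq, spectral_mulVec]
  simp only [form_add_left, form_smul_left]

theorem form_inv_mulVec_left (x y : Fin 3 → ℂ) : form (F.A⁻¹.1 *ᵥ x) y =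
    conj F.m * form x y + conj (F.n - F.m) / form F.a F.r * form x F.r * form F.a y
      + conj (F.l - F.m) / form F.r F.a * form x F.a * form F.r y := by
  rw [F.inv_matrix_eq, spectral_mulVec]
  simp only [form_add_left, form_smul_left]

/-- The imaginary parts of `tr [A, B]` and of `X₃` differ by a negative factor. -/
theorem exists_im_tr_commutator_eq (h : X3Defined E F) :
    ∃ c : ℝ, 0 < c ∧ (tr ⁅E.A, F.A⁆).im = -(c * (X3 E F).im) := by
  obtain ⟨-, -, h₁⟩ := E.tr_commutator F.A
  obtain ⟨h₂, h₃⟩ := h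
  have ha := E.form_a_r
  have ha' := F.form_a_r
  have d₁ := E.discr_eq
  have d₂ := F.discr_eq
  have pos : ∀ K : Loxodromic, 0 < ‖K.l - K.m‖ ^ 2 - ‖K.n - K.m‖ ^ 2 := by
    intro K
    have := K.norm_n_sub_m_lt
    have := norm_nonneg (K.n - K.m)
    nlinarith
  have p₁ := pos E
  have p₂ := pos F
  set c₁ := ‖E.l - E.m‖ ^ 2 - ‖E.n - E.m‖ ^ 2
  set c₂ := ‖F.l - F.m‖ ^ 2 - ‖F.n - F.m‖ ^ 2
  have q₂ : (F.l - F.m) * conj (F.l - F.m) - (F.n - F.m) * conj (F.n - F.m) = c₂ := by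
    rw [Complex.mul_conj', Complex.mul_conj']
    push_cast [c₂]
    ring
  have hN : 0 < ‖form F.r E.a‖ ^ 2 * ‖form F.a E.r‖ ^ 2
      / (‖form E.a E.r‖ ^ 2 * ‖form F.a F.r‖ ^ 2) := by
    have := norm_pos_iff.2 h₂
    have := norm_pos_iff.2 h₃
    have := norm_pos_iff.2 ha
    have := norm_pos_iff.2 ha'
    positivity
  set N := ‖form F.r E.a‖ ^ 2 * ‖form F.a E.r‖ ^ 2
      / (‖form E.a E.r‖ ^ 2 * ‖form F.a F.r‖ ^ 2) with hNdef
  -- Multiplying `X3` by the squared norms of its denominator factors replaces those factors by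
  -- their conjugates in the numerator.
  have hX : (form E.r F.a * form F.r E.r * form E.a F.r * form F.a E.a)
      / (form E.a E.r * form E.r E.a * (form F.a F.r * form F.r F.a)) = N * X3 E F := by
    have hne := form_ne_zero_comm ha
    have hne' := form_ne_zero_comm ha'
    rw [hNdef, X3]
    push_cast
    rw [← Complex.mul_conj', ← Complex.mul_conj', ← Complex.mul_conj', ← Complex.mul_conj',
      conj_form, conj_form, conj_form, conj_form]
    field_simp
  have hX' : (form E.r F.r * form F.a E.r * form E.a F.a * form F.r E.a)
      / (form E.a E.r * form E.r E.a * (form F.a F.r * form F.r F.a)) = N * conj (X3 E F) := by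
    have := congrArg conj hX
    simp only [map_div₀, map_mul, conj_form, Complex.conj_ofReal] at this
    rw [← this]
    ring
  have key : tr ⁅E.A, F.A⁆ - conj (tr ⁅E.A, F.A⁆) =
      ((c₁ * c₂ * N : ℝ) : ℂ) * (conj (X3 E F) - X3 E F) := by
    rw [← tr_commutator_comm, h₁, d₁]
    push_cast
    rw [← q₂]
    have : (c₁ : ℂ) * ((F.l - F.m) * conj (F.l - F.m) - (F.n - F.m) * conj (F.n - F.m)) * N
        * (conj (X3 E F) - X3 E F) =
        (c₁ : ℂ) * ((F.l - F.m) * conj (F.l - F.m) - (F.n - F.m) * conj (F.n - F.m))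
          * (N * conj (X3 E F) - N * X3 E F) := by ring
    rw [this, ← hX, ← hX']
    have hne := form_ne_zero_comm ha
    have hne' := form_ne_zero_comm ha'
    -- As `E.a` and `E.r` are null, the scalar terms vanish. In the antisymmetric difference the
    -- mixed terms in `F.l - F.m` and `F.n - F.m` cancel, leaving the factor `c₂` of `q₂`.
    simp only [form_mulVec_left, form_inv_mulVec_left, E.form_a_a, E.form_r_r]
    field_simp
    ring
  refine ⟨c₁ * c₂ * N, by positivity, ?_⟩
  have := congrArg Complex.im key
  simp only [Complex.sub_im, Complex.conj_im, Complex.im_ofReal_mul] at this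
  linarith

theorem sign_X3 (h : X3Defined E F) :
    SignType.sign (X3 E F).im = -SignType.sign (tr ⁅E.A, F.A⁆).im := by
  obtain ⟨c, hc, h⟩ := exists_im_tr_commutator_eq E F h
  rw [h, Left.sign_neg, neg_neg, sign_mul, sign_pos hc, one_mul]

end Loxodromic

/-! ### The trace determines the leading eigenvalue. -/

/-- The trace of a loxodromic element of `SU(J)` as a function of its largest eigenvalue. -/
noncomputable def traceOfEigenvalue (l : ℂ) : ℂ := l + conj l / l + (conj l)⁻¹

theorem Loxodromic.tr_eq_traceOfEigenvalue (E : Loxodromic) : tr E.A = traceOfEigenvalue E.l := by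
  rw [E.tr_eq, traceOfEigenvalue, ← E.m_eq, ← E.n_eq]

theorem exists_loxodromic_l_eq {l : ℂ} (hl : 1 < ‖l‖) : ∃ E : Loxodromic, E.l = l := by
  have h0 : l ≠ 0 := norm_pos_iff.1 (by linarith)
  have h0' : conj l ≠ 0 := (_root_.map_ne_zero _).2 h0
  let D : SpecialLinearGroup (Fin 3) ℂ := ⟨diagonal ![l, conj l / l, (conj l)⁻¹], by
    simp [det_diagonal, Fin.prod_univ_three]
    field_simp⟩
  have hD : D ∈ SUJ := by
    change (diagonal ![l, conj l / l, (conj l)⁻¹])ᴴ * J * diagonal ![l, conj l / l, (conj l)⁻¹] = J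
    rw [diagonal_conjTranspose]
    ext i j
    fin_cases i <;> fin_cases j <;> simp [J, h0, h0']
  have hev : HasOrderedEigenvalues D l (conj l / l) (conj l)⁻¹ := by
    refine ⟨?_, ?_, ?_⟩
    · change (diagonal ![l, conj l / l, (conj l)⁻¹]).charpoly.roots = _
      rw [charpoly_diagonal, Fin.prod_univ_three,
        roots_mul (by simp [X_sub_C_ne_zero]), roots_mul (by simp [X_sub_C_ne_zero])]
      simp only [roots_X_sub_C]
      rfl
    · rw [norm_div, RCLike.norm_conj, div_self (norm_ne_zero_iff.2 h0)]
      exact hl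
    · rw [norm_div, RCLike.norm_conj, div_self (norm_ne_zero_iff.2 h0), norm_inv, RCLike.norm_conj]
      exact inv_lt_one_of_one_lt₀ hl
  refine ⟨⟨D, l, conj l / l, (conj l)⁻¹, Pi.single 0 1, Pi.single 2 1, hD, hev, by simp, by simp,
    ?_, ?_⟩, rfl⟩
  · ext i; fin_cases i <;> simp [D]
  · ext i; fin_cases i <;> simp [D]

theorem Loxodromic.l_eq_of_tr_eq {E F : Loxodromic} (h : tr E.A = tr F.A) : E.l = F.l := by
  have h' := congrArg conj h
  rw [E.tr_eq, F.tr_eq] at h h'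
  simp only [map_add, E.conj_l, E.conj_m, E.conj_n, F.conj_l, F.conj_m, F.conj_n] at h'
  -- The characteristic polynomial is `x³ - t x² + conj t x - 1`, with `t` the trace, so equal
  -- traces make `F.l` an eigenvalue of `E.A`. Of these only `E.l` has norm above one.
  have key : (F.l - E.l) * (F.l - E.m) * (F.l - E.n) = 0 := by
    linear_combination (-F.l ^ 2) * h + F.l * h' - E.l_mul_m_mul_n + F.l_mul_m_mul_n
  have h₁ := F.one_lt_norm_l
  have h₂ : ‖E.m‖ = 1 := by
    rw [E.m_eq, norm_div, RCLike.norm_conj, div_self (norm_ne_zero_iff.2 E.l_ne_zero)]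
  have h₃ := E.norm_n_lt_one
  rcases mul_eq_zero.1 key with h | h
  · rcases mul_eq_zero.1 h with h | h
    · exact (sub_eq_zero.1 h).symm
    · rw [sub_eq_zero.1 h] at h₁; linarith
  · rw [sub_eq_zero.1 h] at h₁; linarith

theorem bijOn_traceOfEigenvalue : Set.BijOn traceOfEigenvalue {l : ℂ | 1 < ‖l‖}
    {t : ℂ | ∃ A ∈ SUJ, IsLoxodromic A ∧ t = tr A} := by
  refine ⟨?_, ?_, ?_⟩
  · intro l hl
    obtain ⟨E, rfl⟩ := exists_loxodromic_l_eq hl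
    exact ⟨E.A, E.mem, ⟨_, _, _, E.eigenvalues⟩, E.tr_eq_traceOfEigenvalue.symm⟩
  · intro l hl l' hl' h
    obtain ⟨E, rfl⟩ := exists_loxodromic_l_eq hl
    obtain ⟨F, rfl⟩ := exists_loxodromic_l_eq hl'
    rw [← E.tr_eq_traceOfEigenvalue, ← F.tr_eq_traceOfEigenvalue] at h
    exact Loxodromic.l_eq_of_tr_eq h
  · rintro t ⟨A, hA, hlox, rfl⟩
    obtain ⟨E, rfl⟩ := exists_loxodromic hA hlox
    exact ⟨E.l, E.one_lt_norm_l, E.tr_eq_traceOfEigenvalue.symm⟩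

/-! ### The affine passage from cross-ratios to traces. -/

/-- The determinant of the system is `|p|² - |q|²`, which is positive. -/
theorem eq_zero_of_conj_system {p q u v : ℂ} (h : ‖q‖ < ‖p‖) (h₁ : p * u + q * v = 0)
    (h₂ : conj q * u + conj p * v = 0) : u = 0 ∧ v = 0 := by
  have hd : p * conj p - q * conj q ≠ 0 := by
    rw [Complex.mul_conj', Complex.mul_conj']
    norm_cast
    have := norm_nonneg q
    nlinarith
  constructor
  · apply mul_left_cancel₀ hd
    linear_combination conj p * h₁ - q * h₂
  · apply mul_left_cancel₀ hd
    linear_combination p * h₂ - conj q * h₁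

/-- The real-linear part of the passage from the cross-ratios to the traces. -/
noncomputable def crossRatioLinear (p q p' q' : ℂ) : (ℂ × ℂ) →ₗ[ℝ] (ℂ × ℂ) where
  -- The outer conjugation turns `tr (AB)` into the trace of `C = (AB)⁻¹`.
  toFun x := (conj (p * p' * conj x.1 + p * q' * x.2 + q * p' * conj x.2 + q * q' * x.1),
    conj q * p' * conj x.1 + conj q * q' * x.2 + conj p * p' * conj x.2 + conj p * q' * x.1)
  map_add' x y := by
    ext <;> simp only [Prod.fst_add, Prod.snd_add, map_add, map_mul] <;> ring
  map_smul' c x := by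
    ext <;> simp only [Prod.smul_fst, Prod.smul_snd, map_add, map_mul, Complex.real_smul,
      Complex.conj_ofReal, RingHom.id_apply] <;> ring

/-- The map splits into two conjugate systems: one in `p`, `q` for the auxiliary `u`, `v`, then one
in `p'`, `q'` for `conj x`, `y`. -/
theorem crossRatioLinear_injective {p q p' q' : ℂ} (h : ‖q‖ < ‖p‖) (h' : ‖q'‖ < ‖p'‖) :
    Function.Injective (crossRatioLinear p q p' q') := by
  rw [← LinearMap.ker_eq_bot, LinearMap.ker_eq_bot']
  rintro ⟨x, y⟩ hxy
  obtain ⟨h₁, h₂⟩ := Prod.ext_iff.1 hxy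
  simp only [crossRatioLinear, LinearMap.coe_mk, AddHom.coe_mk, Prod.fst_zero, Prod.snd_zero,
    map_eq_zero] at h₁ h₂
  obtain ⟨hu, hv⟩ := eq_zero_of_conj_system (u := p' * conj x + q' * y)
    (v := p' * conj y + q' * x) h (by linear_combination h₁) (by linear_combination h₂)
  have hv' := congrArg conj hv
  simp only [map_add, map_mul, Complex.conj_conj, map_zero] at hv'
  obtain ⟨hx, hy⟩ := eq_zero_of_conj_system h' hu (by linear_combination hv')
  exact Prod.ext ((map_eq_zero _).1 hx) hy

theorem exists_affineEquiv {p q p' q' : ℂ} (h : ‖q‖ < ‖p‖) (h' : ‖q'‖ < ‖p'‖) (c : ℂ × ℂ) :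
    ∃ φ : (ℂ × ℂ) ≃ᵃ[ℝ] (ℂ × ℂ), ∀ x, φ x = c + crossRatioLinear p q p' q' x :=
  ⟨(LinearEquiv.ofInjectiveEndo _ (crossRatioLinear_injective h h')).toAffineEquiv.trans
    (AffineEquiv.constVAdd ℝ _ c), fun _ => rfl⟩

/-- For given eigenvalues, the traces of `C` and the shape invariant depend on the cross-ratios
through a real-affine bijection. -/
theorem exists_affineEquiv_eigenvalues (l l' : ℂ) : ∃ φ : (ℂ × ℂ) ≃ᵃ[ℝ] (ℂ × ℂ),
    ∀ E F : Loxodromic, E.l = l → F.l = l' →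
      (tr (E.A * F.A)⁻¹, sigmaPlus E.A F.A) = φ (X1 E F, X2 E F) := by
  by_cases h : ∃ E F : Loxodromic, E.l = l ∧ F.l = l'
  · obtain ⟨E, F, rfl, rfl⟩ := h
    obtain ⟨φ, hφ⟩ := exists_affineEquiv E.norm_n_sub_m_lt F.norm_n_sub_m_lt
      (conj (3 * E.m * F.m + E.m * ((F.l - F.m) + (F.n - F.m))
          + F.m * ((E.l - E.m) + (E.n - E.m))),
        3 * conj E.m * F.m + conj E.m * ((F.l - F.m) + (F.n - F.m))
          + F.m * (conj (E.l - E.m) + conj (E.n - E.m)) - conj (tr E.A) * tr F.A)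
    refine ⟨φ, fun E' F' hE hF => ?_⟩
    -- The other eigenvalues are functions of `l`, so the map built from one pair serves every pair
    -- with the same leading eigenvalues.
    have hm : E'.m = E.m := by rw [E.m_eq, E'.m_eq, hE]
    have hn : E'.n = E.n := by rw [E.n_eq, E'.n_eq, hE]
    have hm' : F'.m = F.m := by rw [F.m_eq, F'.m_eq, hF]
    have hn' : F'.n = F.n := by rw [F.n_eq, F'.n_eq, hF]
    have ht : tr E'.A = tr E.A := by rw [E.tr_eq, E'.tr_eq, hE, hm, hn]
    have ht' : tr F'.A = tr F.A := by rw [F.tr_eq, F'.tr_eq, hF, hm', hn']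
    rw [hφ, tr_inv (SUJ.mul_mem E'.mem F'.mem), sigmaPlus, tr_inv E'.mem,
      Loxodromic.tr_mul, Loxodromic.tr_inv_mul, hE, hF, hm, hn, hm', hn', ht, ht']
    ext
    · simp only [crossRatioLinear, LinearMap.coe_mk, AddHom.coe_mk, Prod.fst_add, ← map_add]
      congr 1
      ring
    · simp only [crossRatioLinear, LinearMap.coe_mk, AddHom.coe_mk, Prod.snd_add]
      ring
  -- If no pair has these eigenvalues there is nothing to satisfy, and any bijection will do.
  · exact ⟨AffineEquiv.refl ℝ _, fun E F hE hF => (h ⟨E, F, hE, hF⟩).elim⟩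

/-! ### Dependence of `Q` on the coordinates, and the choice of a root. -/

theorem sigmaMinus_eq {A B : SpecialLinearGroup (Fin 3) ℂ} (hA : A ∈ SUJ) (hB : B ∈ SUJ) :
    sigmaMinus A B = conj (sigmaPlus A B) := by
  have h : B⁻¹ * A = (A⁻¹ * B)⁻¹ := by group
  rw [sigmaMinus, sigmaPlus, h, tr_inv (SUJ.mul_mem (SUJ.inv_mem hA) hB), tr_inv hA, tr_inv hB,
    map_sub, map_mul, Complex.conj_conj]
  ring

/-- In `SU(J)` the last four of the eight variables are the conjugates of the first four. -/
theorem Q_eq_of_traceCoords_eq {A B A' B' : SpecialLinearGroup (Fin 3) ℂ} (hA : A ∈ SUJ)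
    (hB : B ∈ SUJ) (hA' : A' ∈ SUJ) (hB' : B' ∈ SUJ) (h : traceCoords A B = traceCoords A' B') :
    Q A B = Q A' B' := by
  simp only [traceCoords, Prod.mk.injEq] at h
  obtain ⟨h₁, h₂, h₃, h₄⟩ := h
  have h₇ : tr (A * B) = tr (A' * B') := by
    rw [tr_inv (SUJ.mul_mem hA hB), tr_inv (SUJ.mul_mem hA' hB')] at h₃
    exact (starRingEnd ℂ).injective h₃
  rw [Q, Q, sigmaMinus_eq hA hB, sigmaMinus_eq hA' hB', tr_inv hA, tr_inv hB, tr_inv hA',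
    tr_inv hB', h₁, h₂, h₃, h₄, h₇]

/-- A complex number is determined by the pair it forms with its conjugate and by the sign of its
imaginary part. -/
theorem eq_of_conj_pair_eq {t t' : ℂ} (h : ({t, conj t} : Multiset ℂ) = {t', conj t'})
    (hs : SignType.sign t.im = SignType.sign t'.im) : t = t' := by
  have ht : t ∈ ({t', conj t'} : Multiset ℂ) := by rw [← h]; simp
  simp only [Multiset.insert_eq_cons, Multiset.mem_cons, Multiset.mem_singleton] at ht
  rcases ht with ht | rfl
  · exact ht
  · rw [Complex.conj_im, Left.sign_neg, SignType.neg_eq_self_iff, sign_eq_zero_iff] at hs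
    exact Complex.conj_eq_iff_im.2 hs

end ParkerPlatis

theorem mainTheorem11 :
    -- the denominators of `X₁` and `X₂` never vanish
    (∀ E : ParkerPlatis.Loxodromic, ParkerPlatis.form E.r E.a ≠ 0) ∧
    -- the bijection of coordinates, with its fibre depending only on the eigenvalues
    (∃ (τ : ℂ → ℂ) (φ : ℂ → ℂ → ((ℂ × ℂ) ≃ᵃ[ℝ] (ℂ × ℂ))),
      Set.BijOn τ {l : ℂ | 1 < ‖l‖}
        {t : ℂ | ∃ A ∈ ParkerPlatis.SUJ, ParkerPlatis.IsLoxodromic A ∧ t = ParkerPlatis.tr A} ∧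
      (∀ E F : ParkerPlatis.Loxodromic,
        ParkerPlatis.tr E.A = τ E.l ∧ ParkerPlatis.tr F.A = τ F.l ∧
        (ParkerPlatis.tr (E.A * F.A)⁻¹, ParkerPlatis.sigmaPlus E.A F.A) =
          φ E.l F.l (ParkerPlatis.X1 E F, ParkerPlatis.X2 E F)) ∧
      Set.BijOn
        (fun p : ℂ × ℂ × ℂ × ℂ => (τ p.1, τ p.2.1, φ p.1 p.2.1 (p.2.2.1, p.2.2.2)))
        {p | ∃ E F : ParkerPlatis.Loxodromic, p = ParkerPlatis.eigenCoords E F}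
        {q | ∃ A ∈ ParkerPlatis.SUJ, ∃ B ∈ ParkerPlatis.SUJ,
          ParkerPlatis.IsLoxodromic A ∧ ParkerPlatis.IsLoxodromic B ∧
            q = ParkerPlatis.traceCoords A B}) ∧
    -- the roots of the commutator quadratic
    (∀ E F : ParkerPlatis.Loxodromic,
      (ParkerPlatis.Q E.A F.A).roots =
        {ParkerPlatis.tr ⁅E.A, F.A⁆, conj (ParkerPlatis.tr ⁅E.A, F.A⁆)}) ∧
    -- the sign of `Im X₃` and the choice of a root
    (∀ E F : ParkerPlatis.Loxodromic, ParkerPlatis.X3Defined E F →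
      SignType.sign (ParkerPlatis.X3 E F).im =
        -SignType.sign (ParkerPlatis.tr ⁅E.A, F.A⁆).im) ∧
    (∀ E F E' F' : ParkerPlatis.Loxodromic,
      ParkerPlatis.X3Defined E F → ParkerPlatis.X3Defined E' F' →
      ParkerPlatis.eigenCoords E F = ParkerPlatis.eigenCoords E' F' →
      ParkerPlatis.Q E.A F.A = ParkerPlatis.Q E'.A F'.A ∧
      (SignType.sign (ParkerPlatis.X3 E F).im = SignType.sign (ParkerPlatis.X3 E' F').im ↔
        ParkerPlatis.tr ⁅E.A, F.A⁆ = ParkerPlatis.tr ⁅E'.A, F'.A⁆)) := by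
  refine ⟨fun E => E.form_r_a, ?_, fun E F => E.roots_Q F, fun E F => E.sign_X3 F, ?_⟩
  · choose φ hφ using ParkerPlatis.exists_affineEquiv_eigenvalues
    refine ⟨ParkerPlatis.traceOfEigenvalue, φ, ParkerPlatis.bijOn_traceOfEigenvalue,
      fun E F => ⟨E.tr_eq_traceOfEigenvalue, F.tr_eq_traceOfEigenvalue, hφ _ _ E F rfl rfl⟩,
      ?_, ?_, ?_⟩
    · rintro _ ⟨E, F, rfl⟩
      refine ⟨E.A, E.mem, F.A, F.mem, ⟨_, _, _, E.eigenvalues⟩, ⟨_, _, _, F.eigenvalues⟩, ?_⟩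
      simp only [ParkerPlatis.eigenCoords, ParkerPlatis.traceCoords, ← hφ _ _ E F rfl rfl,
        E.tr_eq_traceOfEigenvalue, F.tr_eq_traceOfEigenvalue]
    · rintro _ ⟨E, F, rfl⟩ _ ⟨E', F', rfl⟩ h
      simp only [ParkerPlatis.eigenCoords, Prod.mk.injEq] at h ⊢
      obtain ⟨h₁, h₂, h₃⟩ := h
      -- The traces give back both eigenvalues, so both points lie in one fibre, where `φ` is
      -- injective.
      have hl := ParkerPlatis.bijOn_traceOfEigenvalue.injOn E.one_lt_norm_l E'.one_lt_norm_l h₁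
      have hl' := ParkerPlatis.bijOn_traceOfEigenvalue.injOn F.one_lt_norm_l F'.one_lt_norm_l h₂
      rw [hl, hl'] at h₃
      exact ⟨hl, hl', Prod.mk.inj ((φ E'.l F'.l).injective h₃)⟩
    · rintro _ ⟨A, hA, B, hB, hlA, hlB, rfl⟩
      obtain ⟨E, rfl⟩ := ParkerPlatis.exists_loxodromic hA hlA
      obtain ⟨F, rfl⟩ := ParkerPlatis.exists_loxodromic hB hlB
      refine ⟨_, ⟨E, F, rfl⟩, ?_⟩
      simp only [ParkerPlatis.eigenCoords, ParkerPlatis.traceCoords, ← hφ _ _ E F rfl rfl,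
        E.tr_eq_traceOfEigenvalue, F.tr_eq_traceOfEigenvalue]
  · intro E F E' F' h h' hc
    have hQ : ParkerPlatis.Q E.A F.A = ParkerPlatis.Q E'.A F'.A := by
      simp only [ParkerPlatis.eigenCoords, Prod.mk.injEq] at hc
      obtain ⟨h₁, h₂, h₃, h₄⟩ := hc
      obtain ⟨φ, hφ⟩ := ParkerPlatis.exists_affineEquiv_eigenvalues E'.l F'.l
      have h₅ := hφ E F h₁ h₂
      rw [h₃, h₄, ← hφ E' F' rfl rfl] at h₅
      refine ParkerPlatis.Q_eq_of_traceCoords_eq E.mem F.mem E'.mem F'.mem ?_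
      rw [ParkerPlatis.traceCoords, ParkerPlatis.traceCoords, h₅, E.tr_eq_traceOfEigenvalue,
        F.tr_eq_traceOfEigenvalue, E'.tr_eq_traceOfEigenvalue, F'.tr_eq_traceOfEigenvalue, h₁, h₂]
    refine ⟨hQ, ?_⟩
    rw [E.sign_X3 F h, E'.sign_X3 F' h', neg_inj]
    -- Equal quadratics have the same conjugate pair of roots, and the sign of the imaginary part
    -- selects one of them.
    refine ⟨fun hs => ParkerPlatis.eq_of_conj_pair_eq ?_ hs, fun ht => by rw [ht]⟩
    rw [← E.roots_Q F, ← E'.roots_Q F', hQ]
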